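/- **Theorem 1.1 (Bez–Machihara–Ozawa).** Let $\|\cdot\|_2$ be the norm of $L^2(\mathbb{R}^3)$, let $\Delta$ be the Laplacian on $\mathbb{R}^3$, and on $\mathbb{R}^3\setminus\{0\}$ put $$\partial_r=\frac{x}{|x|}\cdot\nabla,\qquad \Delta_r=\partial_r^2+\frac{2}{|x|}\,\partial_r,\qquad \Delta_s=\frac{1}{|x|^2}\,\Delta_{\mathbb{S}^2},$$ where $\Delta_{\mathbb{S}^2}$ is the Laplace–Beltrami operator of the unit sphere $\mathbb{S}^2$, acting in the angular variable $x/|x|$. Then for every complex-valued $f\in C_0^\infty(\mathbb{R}^3\setminus\{0\})$ (smooth, with compact support in $\mathbb{R}^3\setminus\{0\}$), $$\|\Delta f\|_2^2\ \ge\ \|\Delta_r f\|_2^2\qquad\text{and}\qquad \|\Delta f\|_2^2\ \ge\ \Big(\frac58\Big)^2\|\Delta_s f\|_2^2 .$$ Both inequalities are sharp: if $C\ge 0$ is such that $\|\Delta f\|_2^2\ge C\,\|\Delta_r f\|_2^2$ for all $f\in C_0^\infty(\mathbb{R}^3\setminus\{0\})$, then $C\le 1$; and if $C\ge 0$ is such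 that $\|\Delta f\|_2^2\ge C\,\|\Delta_s f\|_2^2$ for all $f\in C_0^\infty(\mathbb{R}^3\setminus\{0\})$, then $C\le (5/8)^2$. -/

import Mathlib

open MeasureTheory InnerProductSpace Laplacian
open scoped NNReal ENNReal Distributions

namespace EvansLewis

/-- Euclidean space `ℝⁿ`. -/
abbrev Eucl (n : ℕ) : Type := EuclideanSpace ℝ (Fin n)

/-- The open set `ℝⁿ ∖ {0}`. -/
def punctured (n : ℕ) : TopologicalSpace.Opens (Eucl n) :=
  ⟨{0}ᶜ, isOpen_compl_singleton⟩

/-- The radial derivative `∂_r f = (x / |x|) · ∇ f`. -/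
noncomputable def radialDeriv {n : ℕ} (f : Eucl n → ℂ) (x : Eucl n) : ℂ :=
  fderiv ℝ f x (‖x‖⁻¹ • x)

/-- The radial Laplacian `Δ_r f = ∂_r² f + ((n - 1) / |x|) ∂_r f`. -/
noncomputable def radialLaplacian {n : ℕ} (f : Eucl n → ℂ) (x : Eucl n) : ℂ :=
  radialDeriv (radialDeriv f) x + ((((n : ℝ) - 1) / ‖x‖ : ℝ) : ℂ) * radialDeriv f x

/-- The Laplace-Beltrami operator of the unit sphere `S^{n-1}`: the value at `ω` is the Euclidean
Laplacian at `ω` of the extension `y ↦ g (y / |y|)`, homogeneous of degree zero, of the function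
`g` on the sphere. Only the values of `g` on the unit sphere matter (for `ω` on the sphere). -/
noncomputable def sphereLaplacian {n : ℕ} (g : Eucl n → ℂ) (ω : Eucl n) : ℂ :=
  (Δ (fun y : Eucl n => g (‖y‖⁻¹ • y))) ω

/-- The spherical part `Δ_s = |x|⁻² Δ_{S^{n-1}}` of the Laplacian: at `x = rω`, `r = |x|`, the
Laplace-Beltrami operator acts on the function `θ ↦ f (rθ)` of the angular variable. -/
noncomputable def sphericalLaplacian {n : ℕ} (f : Eucl n → ℂ) (x : Eucl n) : ℂ :=
  (((‖x‖ ^ 2)⁻¹ : ℝ) : ℂ) * sphereLaplacian (fun θ => f (‖x‖ • θ)) (‖x‖⁻¹ • x)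

/-- The norm of `L²(ℝⁿ)`, with values in `[0, ∞]`. -/
noncomputable def l2norm {n : ℕ} (u : Eucl n → ℂ) : ℝ≥0∞ :=
  eLpNorm u 2 volume

end EvansLewis

/-! Let E = x · ∇, let L₀, L₁, L₂ be the components of x × ∇, and put R = E² + E and Λ = ∑ Lᵢ². Then
|x|²Δ = R + Λ, |x|²Δ_r = R and |x|²Δ_s = Λ, so every norm in the theorem is a norm of L²(|x|⁻⁴dx).
There each Lᵢ is skew, and integration by parts gives E* = 1 − E, so S = E − 1/2 is skew as well.
Since R = S² + 2S + 3/4, ‖Rf‖² = ‖S²f‖² + (5/2)‖Sf‖² + (9/16)‖f‖², 2⟨Rf, Λf⟩ = 2∑‖LᵢSf‖² −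
(3/2)∑‖Lᵢf‖².

The only negative term is controlled by the spectral gap 2∑‖Lᵢf‖² ≤ ‖Λf‖²
(`two_mul_sum_weightedForm_angular_le`). It is proved without spherical harmonics, by a Bochner
argument: a pointwise bound on the matrix LᵢLⱼf, integrated. The first inequality follows because
(3/2)∑‖Lᵢf‖² ≤ (3/4)‖Λf‖². For the second, on the eigenspace Λ = −λ what remains after dropping the
S terms is (λ − 3/4)², which is at least (5/8)²λ² for λ ≥ 2, with equality at λ = 2.

The constant 1 is attained by radial functions. The constant (5/8)² is approached by functions
xᵢ|x|^(-1/2)k(ε log|x|) of angular degree one: on them S acts as d/dt in t = log|x|, and the terms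
containing S disappear as ε → 0. -/

namespace EvansLewis

/-! ### Linear vector fields, rotations and the Laplacian -/

/-- The derivative of `f` along the linear vector field `x ↦ M x`. -/
noncomputable def fieldDeriv {n : ℕ} (M : Eucl n →L[ℝ] Eucl n) (f : Eucl n → ℂ) (x : Eucl n) : ℂ :=
  fderiv ℝ f x (M x)

theorem fieldDeriv_fieldDeriv {n : ℕ} (M N : Eucl n →L[ℝ] Eucl n) {f : Eucl n → ℂ} {x : Eucl n}
    (hf : ContDiffAt ℝ 2 f x) :
    fieldDeriv M (fieldDeriv N f) x
      = fderiv ℝ (fderiv ℝ f) x (M x) (N x) + fderiv ℝ f x (N (M x)) := by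
  have h : DifferentiableAt ℝ (fderiv ℝ f) x :=
    (hf.fderiv_right (m := 1) (by norm_num)).differentiableAt (by norm_num)
  unfold fieldDeriv
  have := (h.hasFDerivAt.clm_apply N.hasFDerivAt).fderiv
  rw [this]
  simp [add_comm]

/-- The infinitesimal rotation `x ↦ eᵢ × x` of `ℝ³`. -/
noncomputable def rot (i : Fin 3) : Eucl 3 →L[ℝ] Eucl 3 :=
  (EuclideanSpace.proj (i + 1) : Eucl 3 →L[ℝ] ℝ).smulRight (EuclideanSpace.single (i + 2) (1 : ℝ))
    - (EuclideanSpace.proj (i + 2) : Eucl 3 →L[ℝ] ℝ).smulRight (EuclideanSpace.single (i + 1) (1 : ℝ))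

theorem rot_apply (i : Fin 3) (x : Eucl 3) :
    rot i x = x (i + 1) • EuclideanSpace.single (i + 2) (1 : ℝ)
      - x (i + 2) • EuclideanSpace.single (i + 1) (1 : ℝ) := by
  simp [rot]

theorem inner_rot_self (i : Fin 3) (x : Eucl 3) : ⟪x, rot i x⟫_ℝ = 0 := by
  simp only [rot_apply, inner_sub_right, inner_smul_right, EuclideanSpace.inner_single_right]
  simp [mul_comm]

/-- The indices are taken modulo 3, so one identity covers the three cyclic cases of the so(3)
relations. -/
theorem rot_commutator (i : Fin 3) :
    rot (i + 1) ∘L rot i - rot i ∘L rot (i + 1) = - rot (i + 2) := by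
  ext x j
  fin_cases i <;> fin_cases j <;> simp [rot_apply]

theorem eucl_three_eq (x : Eucl 3) : x = x 0 • EuclideanSpace.single 0 (1 : ℝ)
    + x 1 • EuclideanSpace.single 1 (1 : ℝ) + x 2 • EuclideanSpace.single 2 (1 : ℝ) := by
  ext j
  fin_cases j <;> simp

theorem norm_sq_eq_three (x : Eucl 3) : ‖x‖ ^ 2 = x 0 ^ 2 + x 1 ^ 2 + x 2 ^ 2 := by
  simp [EuclideanSpace.norm_sq_eq, Fin.sum_univ_three]

/-- The Laplacian of `ℝ³` in terms of the Euler field and the infinitesimal rotations. -/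
theorem norm_sq_smul_laplacian {f : Eucl 3 → ℂ} {x : Eucl 3} (hf : ContDiffAt ℝ 2 f x) :
    (‖x‖ ^ 2) • (Δ f) x = fieldDeriv (.id ℝ _) (fieldDeriv (.id ℝ _) f) x + fieldDeriv (.id ℝ _) f x
      + ∑ i, fieldDeriv (rot i) (fieldDeriv (rot i) f) x := by
  simp only [fieldDeriv_fieldDeriv _ _ hf]
  simp only [laplacian_eq_iteratedFDeriv_orthonormalBasis f (EuclideanSpace.basisFun (Fin 3) ℝ),
    iteratedFDeriv_two_apply, fieldDeriv]
  set A := fderiv ℝ (fderiv ℝ f) x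
  set T := fderiv ℝ f x
  have h : ∀ v w : Eucl 3, A v w = ∑ i, ∑ j, (v i * w j) •
      A (EuclideanSpace.single i 1) (EuclideanSpace.single j 1) := by
    intro v w
    conv_lhs => rw [eucl_three_eq v, eucl_three_eq w]
    simp only [map_add, map_smul, add_apply, smul_apply,
      Fin.sum_univ_three, mul_smul, smul_add]
    module
  have hT : ∀ v : Eucl 3, T v = ∑ i, v i • T (EuclideanSpace.single i 1) := by
    intro v
    conv_lhs => rw [eucl_three_eq v]
    simp [Fin.sum_univ_three]
  rw [norm_sq_eq_three]
  simp only [Fin.sum_univ_three, ContinuousLinearMap.id_apply]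
  rw [h x x, hT x, h (rot 0 x), h (rot 1 x), h (rot 2 x), hT (rot 0 (rot 0 x)),
    hT (rot 1 (rot 1 x)), hT (rot 2 (rot 2 x))]
  simp [Fin.sum_univ_three, rot_apply]
  ring

/-! ### Spherical and radial Laplacians through rotations and the Euler field -/

theorem hasFDerivAt_norm_of_ne_zero {n : ℕ} {x : Eucl n} (hx : x ≠ 0) :
    HasFDerivAt (fun y : Eucl n => ‖y‖) (‖x‖⁻¹ • innerSL ℝ x) x := by
  have h := (hasStrictFDerivAt_norm_sq x).hasFDerivAt.sqrt (by simpa using hx)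
  simp only [Real.sqrt_sq (norm_nonneg _)] at h
  convert! h using 1
  ext v
  simp
  ring

theorem hasFDerivAt_normalize {n : ℕ} (c : ℝ) {y : Eucl n} (hy : y ≠ 0) :
    HasFDerivAt (fun y : Eucl n => c • ‖y‖⁻¹ • y)
      (c • (‖y‖⁻¹ • .id ℝ (Eucl n) + (-(‖y‖ ^ 3)⁻¹ • innerSL ℝ y).smulRight y)) y := by
  have h0 : ‖y‖ ≠ 0 := norm_ne_zero_iff.2 hy
  have h := ((hasDerivAt_inv h0).comp_hasFDerivAt y (hasFDerivAt_norm_of_ne_zero hy))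
  have h2 := (h.smul (hasFDerivAt_id y)).const_smul c
  convert! h2 using 1
  ext v i
  simp
  field_simp
  simp

/-- A skew field is tangent to spheres, so the radial correction in the derivative of y ↦ c y/|y|
vanishes along it. -/
theorem fieldDeriv_comp_normalize_of_skew {n : ℕ} {M : Eucl n →L[ℝ] Eucl n}
    (hM : ∀ x, ⟪x, M x⟫_ℝ = 0) {f : Eucl n → ℂ} (hf : Differentiable ℝ f) (c : ℝ) {y : Eucl n}
    (hy : y ≠ 0) :
    fieldDeriv M (fun y => f (c • ‖y‖⁻¹ • y)) y = fieldDeriv M f (c • ‖y‖⁻¹ • y) := by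
  have h := ((hf _).hasFDerivAt.comp y (hasFDerivAt_normalize c hy)).fderiv
  simp only [Function.comp_def] at h
  rw [fieldDeriv, h]
  simp [hM, fieldDeriv]

theorem fieldDeriv_id_comp_normalize {n : ℕ} {f : Eucl n → ℂ} (hf : Differentiable ℝ f) (c : ℝ)
    {y : Eucl n} (hy : y ≠ 0) :
    fieldDeriv (.id ℝ _) (fun y => f (c • ‖y‖⁻¹ • y)) y = 0 := by
  have h0 : ‖y‖ ≠ 0 := norm_ne_zero_iff.2 hy
  have h := ((hf _).hasFDerivAt.comp y (hasFDerivAt_normalize c hy)).fderiv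
  simp only [Function.comp_def] at h
  rw [fieldDeriv, h]
  have : (c • (‖y‖⁻¹ • .id ℝ (Eucl n) + (-(‖y‖ ^ 3)⁻¹ • innerSL ℝ y).smulRight y)) y = 0 := by
    simp only [smul_apply, add_apply, ContinuousLinearMap.smulRight_apply,
      ContinuousLinearMap.id_apply, innerSL_apply_apply, real_inner_self_eq_norm_sq]
    rw [← add_smul]
    have : ‖y‖⁻¹ + -(‖y‖ ^ 3)⁻¹ • ‖y‖ ^ 2 = 0 := by
      simp only [smul_eq_mul]
      field_simp
      ring
    rw [this, zero_smul, smul_zero]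
  simp only [ContinuousLinearMap.comp_apply, ContinuousLinearMap.id_apply]
  rw [this, map_zero]

theorem fieldDeriv_congr {n : ℕ} {M : Eucl n →L[ℝ] Eucl n} {f g : Eucl n → ℂ} {x : Eucl n}
    (h : ∀ᶠ y in nhds x, f y = g y) : fieldDeriv M f x = fieldDeriv M g x := by
  rw [fieldDeriv, fieldDeriv, Filter.EventuallyEq.fderiv_eq h]

theorem contDiff_fieldDeriv {n : ℕ} (M : Eucl n →L[ℝ] Eucl n) {f : Eucl n → ℂ} {k : ℕ∞}
    (hf : ContDiff ℝ (k + 1) f) : ContDiff ℝ k (fieldDeriv M f) :=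
  (hf.fderiv_right (m := k) le_rfl).clm_apply M.contDiff

/-- The extension of degree zero is killed by the Euler field, and rotations commute with
normalisation. The decomposition of the Laplacian at the unit vector ω therefore leaves only the
squares of the rotations. -/
theorem sphericalLaplacian_eq {f : Eucl 3 → ℂ} (hf : ContDiff ℝ 2 f) {x : Eucl 3} (hx : x ≠ 0) :
    sphericalLaplacian f x
      = (‖x‖ ^ 2)⁻¹ • ∑ i, fieldDeriv (rot i) (fieldDeriv (rot i) f) x := by
  have h0 : ‖x‖ ≠ 0 := norm_ne_zero_iff.2 hx
  set ω : Eucl 3 := ‖x‖⁻¹ • x with hω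
  have hn : ‖ω‖ = 1 := by simp [hω, norm_smul, h0]
  have hω0 : ω ≠ 0 := by
    intro h
    simp [h] at hn
  have hωx : ‖x‖ • ‖ω‖⁻¹ • ω = x := by
    rw [hn, hω, inv_one, one_smul, smul_smul, mul_inv_cancel₀ h0, one_smul]
  set g : Eucl 3 → ℂ := fun y => f (‖x‖ • ‖y‖⁻¹ • y) with hg
  have hev : ∀ᶠ y : Eucl 3 in nhds ω, y ≠ 0 := isOpen_ne.mem_nhds hω0
  have hfd : Differentiable ℝ f := hf.differentiable (by norm_num)
  have hgc : ContDiffAt ℝ 2 g ω := by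
    refine hf.contDiffAt.comp ω ?_
    have hinv : ContDiffAt ℝ 2 (fun y : Eucl 3 => ‖y‖⁻¹) ω :=
      (contDiffAt_norm ℝ hω0).inv (by simp [hn])
    have hid : ContDiffAt ℝ 2 (fun y : Eucl 3 => y) ω := contDiffAt_id
    exact (hinv.smul hid).const_smul ‖x‖
  have h1 : ∀ i, ∀ y : Eucl 3, y ≠ 0 → fieldDeriv (rot i) g y
      = fieldDeriv (rot i) f (‖x‖ • ‖y‖⁻¹ • y) := fun i y hy =>
    fieldDeriv_comp_normalize_of_skew (inner_rot_self i) hfd _ hy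
  have h2 : ∀ i, fieldDeriv (rot i) (fieldDeriv (rot i) g) ω
      = fieldDeriv (rot i) (fieldDeriv (rot i) f) x := by
    intro i
    rw [fieldDeriv_congr (hev.mono (h1 i)), fieldDeriv_comp_normalize_of_skew (inner_rot_self i)
      ((contDiff_fieldDeriv (rot i) (k := 1) (by exact_mod_cast hf)).differentiable (by norm_num))
      _ hω0, hωx]
  have h3 : fieldDeriv (.id ℝ _) (fieldDeriv (.id ℝ _) g) ω = 0 := by
    rw [fieldDeriv_congr (g := fun _ => 0)
      (hev.mono fun y hy => fieldDeriv_id_comp_normalize hfd _ hy)]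
    simp [fieldDeriv]
  have h4 := norm_sq_smul_laplacian hgc
  rw [h3, fieldDeriv_id_comp_normalize hfd _ hω0, hn] at h4
  simp only [one_pow, one_smul, zero_add, h2] at h4
  rw [sphericalLaplacian, sphereLaplacian, ← hω, h4, Complex.real_smul]

theorem radialDeriv_eq {n : ℕ} (f : Eucl n → ℂ) (x : Eucl n) :
    radialDeriv f x = ‖x‖⁻¹ • fieldDeriv (.id ℝ _) f x := by
  simp [radialDeriv, fieldDeriv]

theorem radialLaplacian_eq {f : Eucl 3 → ℂ} (hf : ContDiff ℝ 2 f) {x : Eucl 3} (hx : x ≠ 0) :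
    radialLaplacian f x = (‖x‖ ^ 2)⁻¹ • (fieldDeriv (.id ℝ _) (fieldDeriv (.id ℝ _) f) x
      + fieldDeriv (.id ℝ _) f x) := by
  have h0 : ‖x‖ ≠ 0 := norm_ne_zero_iff.2 hx
  have hE : DifferentiableAt ℝ (fieldDeriv (.id ℝ _) f) x :=
    (contDiff_fieldDeriv _ (k := 1) (by exact_mod_cast hf)).differentiable (by norm_num) x
  have h1 : radialDeriv f = fun y => ‖y‖⁻¹ • fieldDeriv (.id ℝ _) f y :=
    funext fun y => radialDeriv_eq f y
  have h2 := (((hasDerivAt_inv h0).comp_hasFDerivAt x (hasFDerivAt_norm_of_ne_zero hx)).fun_smul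
    hE.hasFDerivAt).fderiv
  rw [radialLaplacian, radialDeriv_eq, h1, fieldDeriv]
  simp only [Function.comp_def] at h2
  rw [h2]
  simp [fieldDeriv]
  have : (‖x‖ : ℂ) ≠ 0 := by exact_mod_cast h0
  field_simp
  ring

/-! ### Vector fields as operators on test functions -/

theorem tsupport_fieldDeriv_subset {n : ℕ} (M : Eucl n →L[ℝ] Eucl n) (f : Eucl n → ℂ) :
    tsupport (fieldDeriv M f) ⊆ tsupport f := by
  refine closure_minimal (fun x hx => ?_) (isClosed_tsupport f)
  by_contra h
  have : fderiv ℝ f x = 0 := image_eq_zero_of_notMem_tsupport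
    fun h' => h (tsupport_fderiv_subset ℝ h')
  simp [fieldDeriv, this] at hx

/-- The derivative along a linear vector field, on test functions. -/
noncomputable def linearField {n : ℕ} (M : Eucl n →L[ℝ] Eucl n) :
    𝓓(punctured n, ℂ) →ₗ[ℝ] 𝓓(punctured n, ℂ) where
  toFun f :=
    { toFun := fieldDeriv M f
      contDiff' := contDiff_fieldDeriv M (by simpa using f.contDiff)
      hasCompactSupport' := f.hasCompactSupport.of_isClosed_subset (isClosed_tsupport _)
        (tsupport_fieldDeriv_subset M f)
      tsupport_subset' := (tsupport_fieldDeriv_subset M f).trans f.tsupport_subset }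
  map_add' f g := by
    ext x
    change fieldDeriv M ⇑(f + g) x = fieldDeriv M f x + fieldDeriv M g x
    have h := ((f.contDiff.differentiable (by simp) x).hasFDerivAt.add
      (g.contDiff.differentiable (by simp) x).hasFDerivAt).fderiv
    have h2 : ⇑(f + g) = ⇑f + ⇑g := by ext; simp
    simp only [fieldDeriv, h2, h, add_apply]
  map_smul' c f := by
    ext x
    change fieldDeriv M ⇑(c • f) x = c • fieldDeriv M f x
    have h := ((f.contDiff.differentiable (by simp) x).hasFDerivAt.const_smul c).fderiv
    have h2 : ⇑(c • f) = c • ⇑f := by ext; simp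
    simp only [fieldDeriv, h2, h, smul_apply]

theorem coe_linearField {n : ℕ} (M : Eucl n →L[ℝ] Eucl n) (f : 𝓓(punctured n, ℂ)) :
    ⇑(linearField M f) = fieldDeriv M f := rfl

theorem contDiff_two {n : ℕ} (f : 𝓓(punctured n, ℂ)) : ContDiff ℝ 2 f :=
  by
  exact_mod_cast contDiff_infty.1 f.contDiff 2

/-- The second derivative is symmetric, so only the first-order terms survive; the matrices come out
in the opposite order to the operators. -/
theorem linearField_commutator {n : ℕ} (M N : Eucl n →L[ℝ] Eucl n) (f : 𝓓(punctured n, ℂ)) :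
    linearField M (linearField N f) - linearField N (linearField M f)
      = linearField (N ∘L M - M ∘L N) f := by
  ext x
  have hs : IsSymmSndFDerivAt ℝ f x :=
    (contDiff_two f).contDiffAt.isSymmSndFDerivAt (by simp)
  simp only [sub_apply, coe_linearField]
  rw [fieldDeriv_fieldDeriv _ _ (contDiff_two f).contDiffAt,
    fieldDeriv_fieldDeriv _ _ (contDiff_two f).contDiffAt, hs.eq (M x) (N x)]
  simp [fieldDeriv]

/-- The Euler operator `x · ∇`. -/
noncomputable def euler (n : ℕ) : 𝓓(punctured n, ℂ) →ₗ[ℝ] 𝓓(punctured n, ℂ) :=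
  linearField (.id ℝ _)

/-- The components of the angular momentum operator `x × ∇`. -/
noncomputable def angular (i : Fin 3) : 𝓓(punctured 3, ℂ) →ₗ[ℝ] 𝓓(punctured 3, ℂ) :=
  linearField (rot i)

theorem euler_linearField {n : ℕ} (M : Eucl n →L[ℝ] Eucl n) (f : 𝓓(punctured n, ℂ)) :
    euler n (linearField M f) = linearField M (euler n f) := by
  have h := linearField_commutator (.id ℝ _) M f
  rw [ContinuousLinearMap.comp_id, ContinuousLinearMap.id_comp, sub_self] at h
  refine sub_eq_zero.1 (h.trans ?_)
  ext x
  simp [coe_linearField, fieldDeriv]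

theorem angular_commutator (i : Fin 3) (f : 𝓓(punctured 3, ℂ)) :
    angular i (angular (i + 1) f) - angular (i + 1) (angular i f) = - angular (i + 2) f := by
  rw [angular, angular, linearField_commutator, rot_commutator]
  ext x
  simp [coe_linearField, fieldDeriv, angular]

/-- The Laplace-Beltrami operator in the angular variable, on test functions. -/
noncomputable def angularLaplacian : 𝓓(punctured 3, ℂ) →ₗ[ℝ] 𝓓(punctured 3, ℂ) :=
  ∑ i, angular i ∘ₗ angular i

theorem angularLaplacian_apply (f : 𝓓(punctured 3, ℂ)) :
    angularLaplacian f = ∑ i, angular i (angular i f) := by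
  simp [angularLaplacian]

/-! ### The weighted inner product and integration by parts -/

/-- The density `|x|⁻⁴ ⟨f, g⟩` of the weighted inner product. -/
noncomputable def density {n : ℕ} (f g : 𝓓(punctured n, ℂ)) (x : Eucl n) : ℝ :=
  (‖x‖ ^ 4)⁻¹ * ⟪f x, g x⟫_ℝ

theorem eventually_eq_zero {n : ℕ} (f : 𝓓(punctured n, ℂ)) : ∀ᶠ x in nhds 0, f x = 0 := by
  have h : (0 : Eucl n) ∉ tsupport f := fun h => by
    simpa [punctured] using f.tsupport_subset h
  exact notMem_tsupport_iff_eventuallyEq.1 h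

/-- The singular weight is harmless because test functions vanish near the origin. -/
theorem contDiff_density {n : ℕ} (f g : 𝓓(punctured n, ℂ)) : ContDiff ℝ 1 (density f g) := by
  refine contDiff_iff_contDiffAt.2 fun x => ?_
  rcases eq_or_ne x 0 with rfl | hx
  · refine (contDiffAt_const (c := (0 : ℝ))).congr_of_eventuallyEq ?_
    filter_upwards [eventually_eq_zero f] with y hy
    simp [density, hy]
  · refine ((contDiffAt_norm ℝ hx).pow 4 |>.inv (by simpa using hx)).mul ?_
    exact ((f.contDiff.of_le (by exact_mod_cast le_top)).inner ℝ
      (g.contDiff.of_le (by exact_mod_cast le_top))).contDiffAt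

theorem hasCompactSupport_density {n : ℕ} (f g : 𝓓(punctured n, ℂ)) :
    HasCompactSupport (density f g) :=
  f.hasCompactSupport.mono fun x hx hf => hx (by simp_all [density])

theorem integrable_density {n : ℕ} (f g : 𝓓(punctured n, ℂ)) : Integrable (density f g) :=
  (contDiff_density f g).continuous.integrable_of_hasCompactSupport (hasCompactSupport_density f g)

/-- The inner product of `L²(|x|⁻⁴ dx)`, on test functions. -/
noncomputable def weightedForm (n : ℕ) : LinearMap.BilinForm ℝ 𝓓(punctured n, ℂ) :=
  LinearMap.mk₂ ℝ (fun f g => ∫ x, density f g x)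
    (fun f f' g => by
      rw [← integral_add (integrable_density f g) (integrable_density f' g)]
      congr 1; ext x; simp [density, inner_add_left]; ring)
    (fun c f g => by
      rw [smul_eq_mul, ← integral_const_mul]
      congr 1; ext x; simp only [density, smul_apply, inner_smul_left]; simp; ring)
    (fun f g g' => by
      rw [← integral_add (integrable_density f g) (integrable_density f g')]
      congr 1; ext x; simp [density, inner_add_right]; ring)
    (fun c f g => by
      rw [smul_eq_mul, ← integral_const_mul]
      congr 1; ext x; simp only [density, smul_apply, inner_smul_right]; simp; ring)

theorem weightedForm_apply {n : ℕ} (f g : 𝓓(punctured n, ℂ)) :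
    weightedForm n f g = ∫ x, density f g x := rfl

theorem weightedForm_comm {n : ℕ} (f g : 𝓓(punctured n, ℂ)) :
    weightedForm n f g = weightedForm n g f := by
  simp only [weightedForm_apply, density, real_inner_comm]

theorem weightedForm_self_nonneg {n : ℕ} (f : 𝓓(punctured n, ℂ)) : 0 ≤ weightedForm n f f := by
  rw [weightedForm_apply]
  refine integral_nonneg fun x => ?_
  simp only [density, Pi.zero_apply]
  have := real_inner_self_nonneg (x := f x)
  positivity

/-- This is the divergence theorem: the field x ↦ Mx has constant divergence tr M. -/
theorem integral_fderiv_linear {n : ℕ} (M : Eucl n →L[ℝ] Eucl n) {h : Eucl n → ℝ}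
    (hc : ContDiff ℝ 1 h) (hs : HasCompactSupport h) :
    ∫ x, fderiv ℝ h x (M x)
      = - (∑ i, M (EuclideanSpace.single i 1) i) * ∫ x, h x := by
  have hd : Continuous (fderiv ℝ h) := hc.continuous_fderiv (by norm_num)
  have hcomp : ∀ (u : Eucl n → ℝ), Continuous u → Integrable fun x => u x * h x := fun u hu =>
    (hu.mul hc.continuous).integrable_of_hasCompactSupport hs.mul_left
  have hcomp' : ∀ (u : Eucl n → ℝ) (v : Eucl n), Continuous u →
      Integrable fun x => u x * fderiv ℝ h x v := fun u v hu =>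
    (hu.mul (hd.clm_apply continuous_const)).integrable_of_hasCompactSupport
      ((hs.fderiv_apply ℝ v).mul_left)
  have hder : ∀ i x, fderiv ℝ (fun x => M x i) x = (EuclideanSpace.proj i).comp M := fun i x =>
    ((EuclideanSpace.proj (𝕜 := ℝ) i).comp M).fderiv
  have hcont : ∀ i, Continuous fun x => M x i := fun i =>
    ((EuclideanSpace.proj (𝕜 := ℝ) i).comp M).continuous
  have key : ∀ i, ∫ x, M x i * fderiv ℝ h x (EuclideanSpace.single i 1)
      = - (M (EuclideanSpace.single i 1) i) * ∫ x, h x := by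
    intro i
    rw [integral_mul_fderiv_eq_neg_fderiv_mul_of_integrable]
    · simp only [hder]
      simp [integral_const_mul]
    · simp only [hder]
      exact hcomp _ continuous_const
    · exact hcomp' _ _ (hcont i)
    · exact hcomp _ (hcont i)
    · exact fun x _ => ((EuclideanSpace.proj (𝕜 := ℝ) i).comp M).differentiableAt
    · exact fun x _ => hc.differentiable (by norm_num) x
  have hexp : ∀ x, fderiv ℝ h x (M x)
      = ∑ i, M x i * fderiv ℝ h x (EuclideanSpace.single i 1) := by
    intro x
    conv_lhs => rw [← (EuclideanSpace.basisFun (Fin n) ℝ).sum_repr (M x)]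
    simp [map_sum]
  simp only [hexp]
  rw [integral_finsetSum _ fun i _ => hcomp' _ _ (hcont i), neg_mul, Finset.sum_mul,
    ← Finset.sum_neg_distrib]
  exact Finset.sum_congr rfl fun i _ => by rw [key, neg_mul]

theorem fderiv_density {n : ℕ} (M : Eucl n →L[ℝ] Eucl n) (f g : 𝓓(punctured n, ℂ)) (x : Eucl n) :
    fderiv ℝ (density f g) x (M x) = density (linearField M f) g x + density f (linearField M g) x
      - 4 * ((‖x‖ ^ 2)⁻¹ * ⟪x, M x⟫_ℝ) * density f g x := by
  rcases eq_or_ne x 0 with rfl | hx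
  · simp [density]
  have h0 : ‖x‖ ≠ 0 := norm_ne_zero_iff.2 hx
  have hf := (f.contDiff.differentiable (by simp)) x
  have hg := (g.contDiff.differentiable (by simp)) x
  have h1 := ((((hasDerivAt_id ‖x‖).pow 4).inv (by simpa using hx)).comp_hasFDerivAt x
    (hasFDerivAt_norm_of_ne_zero hx))
  have h2 := (h1.mul (hf.hasFDerivAt.inner ℝ hg.hasFDerivAt)).fderiv
  have h3 : density f g = (((fun x : ℝ => x) ^ 4)⁻¹ ∘ fun y : Eucl n => ‖y‖)
      * fun t => ⟪f t, g t⟫_ℝ := by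
    ext y; simp [density]
  rw [h3]
  erw [h2]
  simp [density, coe_linearField, fieldDeriv]
  field_simp
  ring

theorem weightedForm_linearField_of_skew {n : ℕ} {M : Eucl n →L[ℝ] Eucl n}
    (hM : ∀ x, ⟪x, M x⟫_ℝ = 0) (f g : 𝓓(punctured n, ℂ)) :
    weightedForm n (linearField M f) g = - weightedForm n f (linearField M g) := by
  have h := integral_fderiv_linear M (contDiff_density f g) (hasCompactSupport_density f g)
  have htr : ∀ i, M (EuclideanSpace.single i 1) i = 0 := fun i => by
    have := hM (EuclideanSpace.single i 1)
    simpa [EuclideanSpace.inner_single_left] using this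
  simp only [fderiv_density, hM, htr, mul_zero, zero_mul, sub_zero, Finset.sum_const_zero,
    neg_zero] at h
  rw [integral_add (integrable_density _ _) (integrable_density _ _)] at h
  simp only [weightedForm_apply]
  linarith

theorem weightedForm_angular (i : Fin 3) (f g : 𝓓(punctured 3, ℂ)) :
    weightedForm 3 (angular i f) g = - weightedForm 3 f (angular i g) :=
  weightedForm_linearField_of_skew (inner_rot_self i) f g

/-- The Euler field has divergence n, and the weight is homogeneous of degree −4; together they give
4 − n. -/
theorem weightedForm_euler {n : ℕ} (f g : 𝓓(punctured n, ℂ)) :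
    weightedForm n (euler n f) g = (4 - n) * weightedForm n f g - weightedForm n f (euler n g) := by
  have h := integral_fderiv_linear (.id ℝ _) (contDiff_density f g) (hasCompactSupport_density f g)
  have h2 : ∀ x : Eucl n, 4 * ((‖x‖ ^ 2)⁻¹ * ⟪x, ContinuousLinearMap.id ℝ _ x⟫_ℝ) * density f g x
      = 4 * density f g x := by
    intro x
    rcases eq_or_ne x 0 with rfl | hx
    · simp [density]
    have h0 : ‖x‖ ≠ 0 := norm_ne_zero_iff.2 hx
    rw [ContinuousLinearMap.id_apply, real_inner_self_eq_norm_sq, inv_mul_cancel₀ (by positivity)]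
    ring
  simp only [fderiv_density, h2] at h
  have hI : Integrable fun x => density (linearField (.id ℝ _) f) g x
      + density f (linearField (.id ℝ _) g) x :=
    (integrable_density _ _).add (integrable_density _ _)
  rw [integral_sub hI ((integrable_density _ _).const_mul 4),
    integral_add (integrable_density _ _) (integrable_density _ _), integral_const_mul] at h
  simp at h
  simp only [weightedForm_apply, euler]
  linarith

/-! ### The L² norms as weighted forms -/

theorem l2norm_sq_eq_of_eq {n : ℕ} (hn : 0 < n) {u : Eucl n → ℂ} {g : 𝓓(punctured n, ℂ)}
    (h : ∀ x ≠ 0, u x = (‖x‖ ^ 2)⁻¹ • g x) :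
    l2norm u ^ 2 = ENNReal.ofReal (weightedForm n g g) := by
  have : Nonempty (Fin n) := ⟨⟨0, hn⟩⟩
  have hae : ∀ᵐ x : Eucl n, x ≠ 0 := by
    rw [ae_iff]; simp
  have h1 : l2norm u ^ 2 = ∫⁻ x, ‖u x‖ₑ ^ 2 := by
    rw [l2norm, ← ENNReal.rpow_natCast, eLpNorm_eq_lintegral_rpow_enorm_toReal (by simp) (by simp),
      ← ENNReal.rpow_mul]
    simp
  rw [h1, weightedForm_apply, ofReal_integral_eq_lintegral_ofReal (integrable_density g g)]
  · refine lintegral_congr_ae (hae.mono fun x hx => ?_)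
    simp only [h x hx, density]
    rw [real_inner_self_eq_norm_sq, ← ofReal_norm, ← ENNReal.ofReal_pow (norm_nonneg _), norm_smul]
    congr 1
    simp
    ring
  · exact Filter.Eventually.of_forall fun x => by
      simp only [density, Pi.zero_apply]
      have := real_inner_self_nonneg (x := g x)
      positivity

theorem l2norm_radialLaplacian_sq (f : 𝓓(punctured 3, ℂ)) :
    l2norm (radialLaplacian f) ^ 2 = ENNReal.ofReal (weightedForm 3
      (euler 3 (euler 3 f) + euler 3 f) (euler 3 (euler 3 f) + euler 3 f)) :=
  l2norm_sq_eq_of_eq (by norm_num) fun x hx => by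
    simp [radialLaplacian_eq (contDiff_two f) hx, euler, coe_linearField]

theorem l2norm_sphericalLaplacian_sq (f : 𝓓(punctured 3, ℂ)) :
    l2norm (sphericalLaplacian f) ^ 2
      = ENNReal.ofReal (weightedForm 3 (angularLaplacian f) (angularLaplacian f)) :=
  l2norm_sq_eq_of_eq (by norm_num) fun x hx => by
    simp [sphericalLaplacian_eq (contDiff_two f) hx, angularLaplacian_apply, Fin.sum_univ_three,
      angular, coe_linearField]

theorem l2norm_laplacian_sq (f : 𝓓(punctured 3, ℂ)) :
    l2norm (Δ (f : Eucl 3 → ℂ)) ^ 2 = ENNReal.ofReal (weightedForm 3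
      (euler 3 (euler 3 f) + euler 3 f + angularLaplacian f)
      (euler 3 (euler 3 f) + euler 3 f + angularLaplacian f)) :=
  l2norm_sq_eq_of_eq (by norm_num) fun x hx => by
    have h0 : ‖x‖ ^ 2 ≠ 0 := pow_ne_zero 2 (norm_ne_zero_iff.2 hx)
    rw [eq_inv_smul_iff₀ h0, norm_sq_smul_laplacian (contDiff_two f).contDiffAt]
    simp [angularLaplacian_apply, Fin.sum_univ_three, angular, euler, coe_linearField]

/-! ### The spectral gap of the sphere -/

/-- The model is a i j = LᵢLⱼf and v j = Lⱼf at the point x. With w = a x, the part w xᵀ/|x|² of the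
matrix has squared norm |w|²/|x|² = |v|², since w is a cross product of v and x with v ⊥ x. What is
left acts on the plane x^⊥ and has the same trace, so its squared norm is at least half the trace
squared. -/
theorem half_trace_sq_add_le {x v : Fin 3 → ℝ} {a : Fin 3 → Fin 3 → ℝ} (hx : x ≠ 0)
    (hv : ∑ j, x j * v j = 0) (hl : ∀ j, ∑ i, x i * a i j = 0)
    (hr : ∀ i, ∑ j, x j * a i j = x (i + 2) * v (i + 1) - x (i + 1) * v (i + 2)) :
    (∑ i, a i i) ^ 2 / 2 + ∑ j, v j ^ 2 ≤ ∑ i, ∑ j, a i j ^ 2 := by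
  set s := ∑ i, x i ^ 2 with hs
  set t := ∑ i, a i i with ht
  set w : Fin 3 → ℝ := fun i => ∑ j, x j * a i j with hw
  have hs0 : 0 < s := by
    obtain ⟨i, hi⟩ := Function.ne_iff.1 hx
    exact Finset.sum_pos' (fun i _ => sq_nonneg _) ⟨i, Finset.mem_univ _, by
      have : x i ≠ 0 := hi
      positivity⟩
  have hww : ∑ i, w i ^ 2 = s * ∑ j, v j ^ 2 - (∑ j, x j * v j) ^ 2 := by
    simp only [hw, hr, hs, Fin.sum_univ_three]
    simp
    ring
  have hxw : ∑ i, x i * w i = 0 := by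
    have : ∑ i, x i * w i = ∑ j, (∑ i, x i * a i j) * x j := by
      simp only [hw, Fin.sum_univ_three]
      ring
    rw [this]
    simp [hl]
  -- The squared entries are those of s times a, less its part along x and its multiple of the
  -- projection onto x^⊥; the factor s = |x|² clears denominators.
  have hB : ∑ i, ∑ j, (s * a i j - w i * x j
      - t / 2 * ((if i = j then s else 0) - x i * x j)) ^ 2
      = s ^ 2 * ∑ i, ∑ j, a i j ^ 2 - s * ∑ i, w i ^ 2 - s ^ 2 * t ^ 2 / 2
        + s * t * ∑ i, x i * w i := by
    simp only [hw, hs, ht, Fin.sum_univ_three]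
    simp
    ring
  have hnn : 0 ≤ ∑ i, ∑ j, (s * a i j - w i * x j
      - t / 2 * ((if i = j then s else 0) - x i * x j)) ^ 2 :=
    Finset.sum_nonneg fun i _ => Finset.sum_nonneg fun j _ => sq_nonneg _
  rw [hB, hxw, hww, hv] at hnn
  have h : 0 ≤ s ^ 2 * (∑ i, ∑ j, a i j ^ 2 - (t ^ 2 / 2 + ∑ j, v j ^ 2)) := by linarith
  have := nonneg_of_mul_nonneg_right h (by positivity)
  linarith

theorem sum_smul_rot (x y : Eucl 3) : ∑ i, x i • rot i y
    = y 2 • (x 1 • EuclideanSpace.single 0 (1 : ℝ) - x 0 • EuclideanSpace.single 1 1)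
      + y 0 • (x 2 • EuclideanSpace.single 1 1 - x 1 • EuclideanSpace.single 2 1)
      + y 1 • (x 0 • EuclideanSpace.single 2 1 - x 2 • EuclideanSpace.single 0 1) := by
  simp only [Fin.sum_univ_three, rot_apply]
  simp
  module

/-- This is x × x = 0; the next identity is x × y = −y × x. -/
theorem sum_smul_rot_self (x : Eucl 3) : ∑ i, x i • rot i x = 0 := by
  rw [sum_smul_rot]
  module

theorem sum_smul_rot_comm (x y : Eucl 3) : ∑ i, x i • rot i y = - ∑ i, y i • rot i x := by
  rw [sum_smul_rot, sum_smul_rot]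
  module

theorem sum_smul_fieldDeriv_rot (f : Eucl 3 → ℂ) (x : Eucl 3) :
    ∑ i, x i • fieldDeriv (rot i) f x = 0 := by
  simpa only [fieldDeriv, map_sum, map_smul, map_zero] using
    congrArg (fderiv ℝ f x) (sum_smul_rot_self x)

/-- The second-order terms cancel by x × x = 0, leaving the derivative of f along x × (eᵢ × x). -/
theorem sum_smul_fieldDeriv_rot_right {f : Eucl 3 → ℂ} {x : Eucl 3} (hf : ContDiffAt ℝ 2 f x)
    (i : Fin 3) : ∑ j, x j • fieldDeriv (rot i) (fieldDeriv (rot j) f) x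
      = x (i + 2) • fieldDeriv (rot (i + 1)) f x - x (i + 1) • fieldDeriv (rot (i + 2)) f x := by
  have h1 := congrArg (fderiv ℝ (fderiv ℝ f) x (rot i x)) (sum_smul_rot_self x)
  have h2 : ∑ j, x j • rot j (rot i x)
      = x (i + 2) • rot (i + 1) x - x (i + 1) • rot (i + 2) x := by
    rw [sum_smul_rot_comm, rot_apply]
    fin_cases i <;> simp [Fin.sum_univ_three] <;> abel
  have h3 := congrArg (fderiv ℝ f x) h2
  simp only [map_sum, map_smul, map_zero, map_sub] at h1 h3
  simp only [fieldDeriv_fieldDeriv _ _ hf, smul_add, Finset.sum_add_distrib, h1, h3, zero_add]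
  rfl

theorem density_angular_le (f : 𝓓(punctured 3, ℂ)) (x : Eucl 3) :
    density (angularLaplacian f) (angularLaplacian f) x / 2
      + ∑ j, density (angular j f) (angular j f) x
      ≤ ∑ i, ∑ j, density (angular i (angular j f)) (angular i (angular j f)) x := by
  rcases eq_or_ne x 0 with rfl | hx
  · simp [density]
  have hx' : (fun i => x i) ≠ 0 := fun h => hx (by ext i; exact congrFun h i)
  have hv := sum_smul_fieldDeriv_rot f x
  have hl := fun j => sum_smul_fieldDeriv_rot (fieldDeriv (rot j) f) x
  have hr := sum_smul_fieldDeriv_rot_right (contDiff_two f).contDiffAt (x := x)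
  have hre := half_trace_sq_add_le (x := fun i => x i) (v := fun j => (fieldDeriv (rot j) f x).re)
    (a := fun i j => (fieldDeriv (rot i) (fieldDeriv (rot j) f) x).re) hx'
    (by simpa using congrArg Complex.re hv)
    (fun j => by simpa using congrArg Complex.re (hl j))
    (fun i => by simpa using congrArg Complex.re (hr i))
  have him := half_trace_sq_add_le (x := fun i => x i) (v := fun j => (fieldDeriv (rot j) f x).im)
    (a := fun i j => (fieldDeriv (rot i) (fieldDeriv (rot j) f) x).im) hx'
    (by simpa using congrArg Complex.im hv)
    (fun j => by simpa using congrArg Complex.im (hl j))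
    (fun i => by simpa using congrArg Complex.im (hr i))
  have hin : ∀ z : ℂ, ⟪z, z⟫_ℝ = z.re ^ 2 + z.im ^ 2 := fun z => by
    rw [Complex.inner]; simp; ring
  have hL : angularLaplacian f x = ∑ i, fieldDeriv (rot i) (fieldDeriv (rot i) f) x := by
    simp [angularLaplacian_apply, Fin.sum_univ_three, angular, coe_linearField]
  simp only [density, angular, coe_linearField, hin, hL, Complex.re_sum, Complex.im_sum,
    ← Finset.mul_sum, Finset.sum_add_distrib]
  rw [mul_div_assoc, ← mul_add]
  refine mul_le_mul_of_nonneg_left ?_ (by positivity)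
  linarith

/-- The Casimir element of so(3) is central. -/
theorem angularLaplacian_angular (j : Fin 3) (f : 𝓓(punctured 3, ℂ)) :
    angularLaplacian (angular j f) = angular j (angularLaplacian f) := by
  have h0 := fun g => sub_eq_iff_eq_add.1 (angular_commutator 0 g)
  have h1 := fun g => sub_eq_iff_eq_add.1 (angular_commutator 1 g)
  have h2 := fun g => sub_eq_iff_eq_add.1 (angular_commutator 2 g)
  simp only [Fin.isValue, show (0 : Fin 3) + 1 = 1 from rfl, show (0 : Fin 3) + 2 = 2 from rfl,
    show (1 : Fin 3) + 1 = 2 from rfl, show (1 : Fin 3) + 2 = 0 from rfl,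
    show (2 : Fin 3) + 1 = 0 from rfl, show (2 : Fin 3) + 2 = 1 from rfl] at h0 h1 h2
  simp only [angularLaplacian_apply, Fin.sum_univ_three]
  fin_cases j <;> simp only [Fin.zero_eta, Fin.mk_one, Fin.reduceFinMk, Fin.isValue, h0, h1, h2,
    map_add, map_neg] <;> abel

theorem weightedForm_angularLaplacian (f g : 𝓓(punctured 3, ℂ)) :
    weightedForm 3 f (angularLaplacian g) = - ∑ i, weightedForm 3 (angular i f) (angular i g) := by
  simp [angularLaplacian_apply, weightedForm_angular]

/-- The spectral gap of the Laplace-Beltrami operator of the sphere. -/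
theorem two_mul_sum_weightedForm_angular_le (f : 𝓓(punctured 3, ℂ)) :
    2 * ∑ j, weightedForm 3 (angular j f) (angular j f)
      ≤ weightedForm 3 (angularLaplacian f) (angularLaplacian f) := by
  have h1 : weightedForm 3 (angularLaplacian f) (angularLaplacian f) / 2
      + ∑ j, weightedForm 3 (angular j f) (angular j f)
      ≤ ∑ i, ∑ j, weightedForm 3 (angular i (angular j f)) (angular i (angular j f)) := by
    have h := integral_mono (μ := volume)
      (((integrable_density (angularLaplacian f) (angularLaplacian f)).div_const 2).add
        (integrable_finsetSum Finset.univ fun j _ => integrable_density (angular j f) (angular j f)))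
      (integrable_finsetSum Finset.univ fun i _ => integrable_finsetSum Finset.univ fun j _ =>
        integrable_density (angular i (angular j f)) (angular i (angular j f)))
      (fun x => by simpa using density_angular_le f x)
    simp only [Pi.add_apply] at h
    rw [integral_add ((integrable_density _ _).div_const 2)
      (integrable_finsetSum _ fun j _ => integrable_density _ _), integral_div,
      integral_finsetSum _ fun j _ => integrable_density _ _,
      integral_finsetSum _ fun i _ => integrable_finsetSum _ fun j _ => integrable_density _ _] at h
    simp_rw [integral_finsetSum Finset.univ fun j _ => integrable_density _ _] at h
    exact h
  -- Skewness turns the sum over i into −⟨Lⱼf, ΛLⱼf⟩; commuting Λ past Lⱼ and moving Lⱼ across gives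
  -- ⟨Λf, Lⱼ²f⟩.
  have h2 : ∑ i, ∑ j, weightedForm 3 (angular i (angular j f)) (angular i (angular j f))
      = weightedForm 3 (angularLaplacian f) (angularLaplacian f) := by
    rw [Finset.sum_comm]
    have h3 : ∀ j, ∑ i, weightedForm 3 (angular i (angular j f)) (angular i (angular j f))
        = weightedForm 3 (angularLaplacian f) (angular j (angular j f)) := fun j => by
      rw [← neg_inj, ← weightedForm_angularLaplacian, angularLaplacian_angular, weightedForm_comm,
        weightedForm_angular]
    simp only [h3, ← map_sum, ← angularLaplacian_apply]
  linarith

/-! ### The skew part of the Euler operator and the two inequalities -/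

/-- The skew-adjoint part `x · ∇ - 1/2` of the Euler operator. -/
noncomputable def skewEuler : 𝓓(punctured 3, ℂ) →ₗ[ℝ] 𝓓(punctured 3, ℂ) :=
  euler 3 - (1 / 2 : ℝ) • LinearMap.id

theorem euler_eq (f : 𝓓(punctured 3, ℂ)) : euler 3 f = skewEuler f + (1 / 2 : ℝ) • f := by
  simp [skewEuler]

theorem weightedForm_skewEuler (f g : 𝓓(punctured 3, ℂ)) :
    weightedForm 3 (skewEuler f) g = - weightedForm 3 f (skewEuler g) := by
  simp only [skewEuler, LinearMap.sub_apply, LinearMap.smul_apply, LinearMap.id_apply, map_sub,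
    map_smul, weightedForm_euler, smul_eq_mul]
  push_cast
  ring

theorem weightedForm_self_skewEuler (f : 𝓓(punctured 3, ℂ)) :
    weightedForm 3 f (skewEuler f) = 0 := by
  have h := weightedForm_skewEuler f f
  rw [weightedForm_comm] at h
  linarith

theorem skewEuler_angular (i : Fin 3) (f : 𝓓(punctured 3, ℂ)) :
    skewEuler (angular i f) = angular i (skewEuler f) := by
  simp [skewEuler, angular, euler_linearField]

theorem radialPart_eq (f : 𝓓(punctured 3, ℂ)) : euler 3 (euler 3 f) + euler 3 f
    = skewEuler (skewEuler f) + (2 : ℝ) • skewEuler f + (3 / 4 : ℝ) • f := by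
  simp only [euler_eq, map_add, map_smul]
  module

/-- The odd cross terms vanish by skewness, and ⟨S²f, f⟩ = −‖Sf‖² gives 5/2 = 2² − 2 · 3/4. -/
theorem weightedForm_radialPart (f : 𝓓(punctured 3, ℂ)) :
    weightedForm 3 (euler 3 (euler 3 f) + euler 3 f) (euler 3 (euler 3 f) + euler 3 f)
      = weightedForm 3 (skewEuler (skewEuler f)) (skewEuler (skewEuler f))
        + 5 / 2 * weightedForm 3 (skewEuler f) (skewEuler f) + 9 / 16 * weightedForm 3 f f := by
  rw [radialPart_eq]
  have h1 := weightedForm_self_skewEuler f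
  have h2 := weightedForm_self_skewEuler (skewEuler f)
  have h3 := weightedForm_skewEuler (skewEuler f) f
  have h4 := weightedForm_comm (skewEuler (skewEuler f)) (skewEuler f)
  have h5 := weightedForm_comm (skewEuler (skewEuler f)) f
  have h6 := weightedForm_comm (skewEuler f) f
  simp only [map_add, map_smul, LinearMap.add_apply, LinearMap.smul_apply, smul_eq_mul]
  linarith

theorem weightedForm_radialPart_angularLaplacian (f : 𝓓(punctured 3, ℂ)) :
    weightedForm 3 (euler 3 (euler 3 f) + euler 3 f) (angularLaplacian f)
      = ∑ i, weightedForm 3 (angular i (skewEuler f)) (angular i (skewEuler f))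
        - 3 / 4 * ∑ i, weightedForm 3 (angular i f) (angular i f) := by
  rw [radialPart_eq]
  have h1 : ∀ i, weightedForm 3 (angular i (skewEuler f)) (angular i f) = 0 := fun i => by
    rw [← skewEuler_angular, weightedForm_comm, weightedForm_self_skewEuler]
  have h2 : ∀ i, weightedForm 3 (angular i (skewEuler (skewEuler f))) (angular i f)
      = - weightedForm 3 (angular i (skewEuler f)) (angular i (skewEuler f)) := fun i => by
    rw [← skewEuler_angular, weightedForm_skewEuler, skewEuler_angular]
  simp only [map_add, map_smul, LinearMap.add_apply, LinearMap.smul_apply, smul_eq_mul,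
    weightedForm_angularLaplacian, h1, h2]
  simp
  ring

theorem weightedForm_laplacian (f : 𝓓(punctured 3, ℂ)) :
    weightedForm 3 (euler 3 (euler 3 f) + euler 3 f + angularLaplacian f)
        (euler 3 (euler 3 f) + euler 3 f + angularLaplacian f)
      = weightedForm 3 (euler 3 (euler 3 f) + euler 3 f) (euler 3 (euler 3 f) + euler 3 f)
        + 2 * ∑ i, weightedForm 3 (angular i (skewEuler f)) (angular i (skewEuler f))
        - 3 / 2 * ∑ i, weightedForm 3 (angular i f) (angular i f)
        + weightedForm 3 (angularLaplacian f) (angularLaplacian f) := by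
  have h := weightedForm_radialPart_angularLaplacian f
  have h' := weightedForm_comm (angularLaplacian f) (euler 3 (euler 3 f) + euler 3 f)
  generalize euler 3 (euler 3 f) + euler 3 f = R at h h' ⊢
  simp only [map_add, LinearMap.add_apply]
  linarith

theorem weightedForm_radialPart_le (f : 𝓓(punctured 3, ℂ)) :
    weightedForm 3 (euler 3 (euler 3 f) + euler 3 f) (euler 3 (euler 3 f) + euler 3 f)
      ≤ weightedForm 3 (euler 3 (euler 3 f) + euler 3 f + angularLaplacian f)
        (euler 3 (euler 3 f) + euler 3 f + angularLaplacian f) := by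
  rw [weightedForm_laplacian]
  have h1 := two_mul_sum_weightedForm_angular_le f
  have h2 : 0 ≤ ∑ i, weightedForm 3 (angular i (skewEuler f)) (angular i (skewEuler f)) :=
    Finset.sum_nonneg fun i _ => weightedForm_self_nonneg _
  have h3 : 0 ≤ ∑ i, weightedForm 3 (angular i f) (angular i f) :=
    Finset.sum_nonneg fun i _ => weightedForm_self_nonneg _
  linarith

theorem weightedForm_angularLaplacian_le (f : 𝓓(punctured 3, ℂ)) :
    (5 / 8) ^ 2 * weightedForm 3 (angularLaplacian f) (angularLaplacian f)
      ≤ weightedForm 3 (euler 3 (euler 3 f) + euler 3 f + angularLaplacian f)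
        (euler 3 (euler 3 f) + euler 3 f + angularLaplacian f) := by
  rw [weightedForm_laplacian, weightedForm_radialPart]
  have h1 := two_mul_sum_weightedForm_angular_le f
  have h2 : 0 ≤ ∑ i, weightedForm 3 (angular i (skewEuler f)) (angular i (skewEuler f)) :=
    Finset.sum_nonneg fun i _ => weightedForm_self_nonneg _
  have h3 := weightedForm_self_nonneg (skewEuler f)
  have h4 := weightedForm_self_nonneg (skewEuler (skewEuler f))
  have h5 := weightedForm_self_nonneg (angularLaplacian f + (2 : ℝ) • f)
  have h6 := weightedForm_angularLaplacian f f
  have h7 := weightedForm_comm f (angularLaplacian f)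
  simp only [map_add, map_smul, LinearMap.add_apply, LinearMap.smul_apply, smul_eq_mul] at h5
  -- With the terms in S dropped, the difference is at least 9/64 times ‖(Λ + 2)f‖² plus 15/32 times
  -- the deficit in the spectral gap.
  linarith

/-! ### Test functions and sharpness -/

/-- The function `p(x) G(log |x|)`. -/
noncomputable def annularFun {n : ℕ} (p : Eucl n → ℝ) (G : ℝ → ℝ) (x : Eucl n) : ℂ :=
  ((p x * G (Real.log ‖x‖) : ℝ) : ℂ)

/-- The condition p 0 = 0 is needed because `Real.log 0 = 0`: without it the function could take the
value p 0 * G 0 at the origin. -/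
theorem exists_coe_eq_annularFun {n : ℕ} {p : Eucl n → ℝ} {G : ℝ → ℝ}
    (hp : ContDiff ℝ (⊤ : ℕ∞) p) (hp0 : p 0 = 0) (hG : ContDiff ℝ (⊤ : ℕ∞) G)
    (hs : HasCompactSupport G) : ∃ f : 𝓓(punctured n, ℂ), ⇑f = annularFun p G := by
  obtain ⟨R, hR⟩ := hs.isCompact.isBounded.subset_closedBall 0
  set K : Set (Eucl n) := {x | Real.exp (-R) ≤ ‖x‖ ∧ ‖x‖ ≤ Real.exp R} with hK
  have hKc : IsClosed K :=
    (isClosed_le continuous_const continuous_norm).inter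
      (isClosed_le continuous_norm continuous_const)
  have hKb : IsCompact K := by
    refine (isCompact_closedBall (0 : Eucl n) (Real.exp R)).of_isClosed_subset hKc fun x hx => ?_
    simpa using hx.2
  have hK0 : ∀ x ∈ K, x ≠ 0 := by
    rintro x hx rfl
    have := hx.1
    rw [norm_zero] at this
    exact absurd (Real.exp_pos (-R)) (not_lt.2 this)
  have hsub : Function.support (annularFun p G) ⊆ K := by
    intro x hx
    have hx0 : x ≠ 0 := by
      rintro rfl
      simp [annularFun, hp0] at hx
    have hn : 0 < ‖x‖ := norm_pos_iff.2 hx0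
    have hl : Real.log ‖x‖ ∈ tsupport G := subset_tsupport _ fun h => by
      simp [annularFun, h] at hx
    have h := hR hl
    rw [mem_closedBall_zero_iff, Real.norm_eq_abs, abs_le] at h
    exact ⟨(Real.le_log_iff_exp_le hn).1 h.1, (Real.log_le_iff_le_exp hn).1 h.2⟩
  have hts : tsupport (annularFun p G) ⊆ K := closure_minimal hsub hKc
  refine ⟨⟨annularFun p G, ?_, hKb.of_isClosed_subset (isClosed_tsupport _) hts, fun x hx => ?_⟩,
    rfl⟩
  · refine contDiff_iff_contDiffAt.2 fun x => ?_
    by_cases hx : x = 0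
    · have h0 : x ∉ tsupport (annularFun p G) := fun h => hK0 x (hts h) hx
      exact (contDiffAt_const (c := (0 : ℂ))).congr_of_eventuallyEq
        (notMem_tsupport_iff_eventuallyEq.1 h0)
    · refine Complex.ofRealCLM.contDiff.contDiffAt.comp x (hp.contDiffAt.mul ?_)
      exact hG.contDiffAt.comp x ((contDiffAt_norm ℝ hx).log (norm_ne_zero_iff.2 hx))
  · simpa [punctured] using hK0 x (hts hx)

theorem fieldDeriv_annularFun {n : ℕ} (M : Eucl n →L[ℝ] Eucl n) {p : Eucl n → ℝ} {G : ℝ → ℝ}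
    (hp : Differentiable ℝ p) (hG : Differentiable ℝ G) {x : Eucl n} (hx : x ≠ 0) :
    fieldDeriv M (annularFun p G) x = ((fderiv ℝ p x (M x) * G (Real.log ‖x‖)
      + p x * (deriv G (Real.log ‖x‖) * ((‖x‖ ^ 2)⁻¹ * ⟪x, M x⟫_ℝ)) : ℝ) : ℂ) := by
  have h0 : ‖x‖ ≠ 0 := norm_ne_zero_iff.2 hx
  have h1 := ((hG (Real.log ‖x‖)).hasDerivAt.comp ‖x‖ (Real.hasDerivAt_log h0)).comp_hasFDerivAt x
    (hasFDerivAt_norm_of_ne_zero hx)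
  have h2 : HasFDerivAt (annularFun p G) _ x :=
    Complex.ofRealCLM.hasFDerivAt.comp x ((hp x).hasFDerivAt.mul h1)
  rw [fieldDeriv, h2.fderiv]
  simp
  field_simp
  ring

theorem fieldDeriv_annularFun_of_skew {n : ℕ} {M : Eucl n →L[ℝ] Eucl n}
    (hM : ∀ x, ⟪x, M x⟫_ℝ = 0) {p : Eucl n → ℝ} {G : ℝ → ℝ} (hp : Differentiable ℝ p)
    (hG : Differentiable ℝ G) :
    fieldDeriv M (annularFun p G) = annularFun (fun x => fderiv ℝ p x (M x)) G := by
  ext x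
  rcases eq_or_ne x 0 with rfl | hx
  · simp [fieldDeriv, annularFun]
  · rw [fieldDeriv_annularFun M hp hG hx, hM]
    simp [annularFun]

theorem fieldDeriv_id_annularFun {n : ℕ} (l : Eucl n →L[ℝ] ℝ) {G : ℝ → ℝ}
    (hG : Differentiable ℝ G) :
    fieldDeriv (.id ℝ _) (annularFun l G) = annularFun l (G + deriv G) := by
  ext x
  rcases eq_or_ne x 0 with rfl | hx
  · simp [fieldDeriv, annularFun]
  · have h0 : ‖x‖ ≠ 0 := norm_ne_zero_iff.2 hx
    rw [fieldDeriv_annularFun _ l.differentiable hG hx, ContinuousLinearMap.id_apply,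
      real_inner_self_eq_norm_sq, inv_mul_cancel₀ (by positivity)]
    simp [annularFun]
    ring

/-- Linear functions are spherical harmonics of degree one, with eigenvalue −2, because ∑ eᵢ × (eᵢ ×
x) = −2x. -/
theorem angularLaplacian_of_coe_eq_annularFun {f : 𝓓(punctured 3, ℂ)} {l : Eucl 3 →L[ℝ] ℝ}
    {G : ℝ → ℝ} (hG : Differentiable ℝ G) (hf : ⇑f = annularFun l G) :
    angularLaplacian f = -((2 : ℝ) • f) := by
  have h1 : ∀ i, ⇑(angular i (angular i f)) = annularFun (l ∘L rot i ∘L rot i) G := fun i => by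
    have h2 : (fun x => fderiv ℝ l x (rot i x)) = l ∘L rot i := by ext x; simp
    have h3 : (fun x => fderiv ℝ (l ∘L rot i) x (rot i x)) = l ∘L rot i ∘L rot i := by ext x; simp
    rw [angular, coe_linearField, coe_linearField, hf,
      fieldDeriv_annularFun_of_skew (inner_rot_self i) l.differentiable hG, h2,
      fieldDeriv_annularFun_of_skew (inner_rot_self i) (l ∘L rot i).differentiable hG, h3]
  ext x
  have h4 : ∑ i, rot i (rot i x) = -((2 : ℝ) • x) := by
    conv_rhs => rw [eucl_three_eq x]
    simp only [Fin.sum_univ_three, rot_apply]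
    simp
    module
  have h5 := congrArg l h4
  simp only [Fin.sum_univ_three, map_add, map_neg, map_smul, smul_eq_mul] at h5
  rw [angularLaplacian_apply]
  simp only [Fin.sum_univ_three, add_apply, h1, neg_apply, smul_apply, hf, annularFun,
    ContinuousLinearMap.comp_apply, Complex.real_smul]
  norm_cast
  linear_combination (G (Real.log ‖x‖)) * h5

/-- The profile `e^{-t/2} k(t)`. -/
noncomputable def logProfile (k : ℝ → ℝ) (t : ℝ) : ℝ := Real.exp (-t / 2) * k t

theorem contDiff_logProfile {k : ℝ → ℝ} (hk : ContDiff ℝ (⊤ : ℕ∞) k) :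
    ContDiff ℝ (⊤ : ℕ∞) (logProfile k) :=
  (Real.contDiff_exp.comp (contDiff_neg.div_const 2)).mul hk

theorem hasCompactSupport_logProfile {k : ℝ → ℝ} (hk : HasCompactSupport k) :
    HasCompactSupport (logProfile k) := hk.mul_left

theorem deriv_logProfile {k : ℝ → ℝ} (hk : Differentiable ℝ k) :
    deriv (logProfile k) = logProfile (deriv k) - (1 / 2 : ℝ) • logProfile k := by
  ext t
  have h : HasDerivAt (logProfile k) _ t :=
    (((hasDerivAt_neg t).div_const 2).exp).mul (hk t).hasDerivAt
  rw [h.deriv]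
  simp [logProfile]
  ring

/-- On l(x)G(log|x|) the operator E − 1/2 acts as G ↦ G' + G/2; the factor e^(-t/2) in the profile
absorbs G/2. -/
theorem skewEuler_of_coe_eq_annularFun {f : 𝓓(punctured 3, ℂ)} {l : Eucl 3 →L[ℝ] ℝ}
    {k : ℝ → ℝ} (hk : ContDiff ℝ (⊤ : ℕ∞) k) (hf : ⇑f = annularFun l (logProfile k)) :
    ⇑(skewEuler f) = annularFun l (logProfile (deriv k)) := by
  ext x
  have h1 : euler 3 f x = annularFun l (logProfile k + deriv (logProfile k)) x := by
    rw [euler, coe_linearField, hf, fieldDeriv_id_annularFun l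
      ((contDiff_logProfile hk).differentiable (by simp))]
  simp only [skewEuler, LinearMap.sub_apply, LinearMap.smul_apply, LinearMap.id_apply, sub_apply,
    smul_apply, h1, hf, deriv_logProfile (hk.differentiable (by simp))]
  simp [annularFun]
  ring

theorem integral_Ioi_eq_integral_exp (h : ℝ → ℝ) :
    ∫ y in Set.Ioi 0, h y = ∫ t, Real.exp t * h (Real.exp t) := by
  have := integral_image_eq_integral_abs_deriv_smul MeasurableSet.univ
    (fun x _ => (Real.hasDerivAt_exp x).hasDerivWithinAt) Real.exp_injective.injOn h
  simpa [Set.image_univ, Real.range_exp, Real.abs_exp] using this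

/-- Summing over the coordinates replaces xᵢ² by |x|² and makes the integrand radial. In polar
coordinates with r = e^t all powers of r cancel, and 3 vol(B) is the area of the sphere. -/
theorem sum_weightedForm_annularFun {f : Fin 3 → 𝓓(punctured 3, ℂ)} {k : ℝ → ℝ}
    (hf : ∀ i, ⇑(f i) = annularFun (EuclideanSpace.proj i : Eucl 3 →L[ℝ] ℝ) (logProfile k)) :
    ∑ i, weightedForm 3 (f i) (f i)
      = 3 * volume.real (Metric.ball (0 : Eucl 3) 1) * ∫ t, k t ^ 2 := by
  have h1 : ∀ x, ∑ i, density (f i) (f i) x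
      = (‖x‖ ^ 4)⁻¹ * (‖x‖ ^ 2 * logProfile k (Real.log ‖x‖) ^ 2) := by
    intro x
    simp only [density, hf, annularFun, Fin.sum_univ_three]
    rw [norm_sq_eq_three x]
    simp [mul_pow]
    ring
  simp only [weightedForm_apply]
  rw [← integral_finsetSum _ fun i _ => integrable_density _ _]
  simp only [h1]
  rw [integral_fun_norm_addHaar volume
    (fun r => (r ^ 4)⁻¹ * (r ^ 2 * logProfile k (Real.log r) ^ 2)), integral_Ioi_eq_integral_exp]
  have h2 : ∀ t, Real.exp t * (Real.exp t ^ (Module.finrank ℝ (Eucl 3) - 1)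
      • ((Real.exp t ^ 4)⁻¹ * (Real.exp t ^ 2 * logProfile k (Real.log (Real.exp t)) ^ 2)))
      = k t ^ 2 := by
    intro t
    have h3 : Real.exp (-t / 2) ^ 2 * Real.exp t = 1 := by
      rw [← Real.exp_nat_mul, ← Real.exp_add]
      simp
      ring_nf
    have h4 : Real.exp t ^ 4 ≠ 0 := pow_ne_zero 4 (Real.exp_ne_zero t)
    simp only [finrank_euclideanSpace, Fintype.card_fin, Real.log_exp, logProfile, smul_eq_mul]
    calc _ = Real.exp (-t / 2) ^ 2 * Real.exp t * k t ^ 2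
          * (Real.exp t ^ 4 * (Real.exp t ^ 4)⁻¹) := by ring
      _ = k t ^ 2 := by rw [h3, mul_inv_cancel₀ h4, one_mul, mul_one]
  simp only [h2]
  simp
  ring

/-- With Λ = −2 the coefficients are 13/2 = 5/2 + 2 · 2 and 25/16 = 9/16 − (3/2) · 2 + 4 = (2 −
3/4)². -/
theorem weightedForm_laplacian_of_coe_eq_annularFun {f : 𝓓(punctured 3, ℂ)} {l : Eucl 3 →L[ℝ] ℝ}
    {k : ℝ → ℝ} (hk : ContDiff ℝ (⊤ : ℕ∞) k) (hf : ⇑f = annularFun l (logProfile k)) :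
    weightedForm 3 (euler 3 (euler 3 f) + euler 3 f + angularLaplacian f)
        (euler 3 (euler 3 f) + euler 3 f + angularLaplacian f)
      = weightedForm 3 (skewEuler (skewEuler f)) (skewEuler (skewEuler f))
        + 13 / 2 * weightedForm 3 (skewEuler f) (skewEuler f)
        + 25 / 16 * weightedForm 3 f f := by
  have hd : ContDiff ℝ (⊤ : ℕ∞) (deriv k) := (contDiff_infty_iff_deriv.1 hk).2
  have h1 := angularLaplacian_of_coe_eq_annularFun
    ((contDiff_logProfile hk).differentiable (by simp)) hf
  have h2 := angularLaplacian_of_coe_eq_annularFun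
    ((contDiff_logProfile hd).differentiable (by simp)) (skewEuler_of_coe_eq_annularFun hk hf)
  have h3 := weightedForm_angularLaplacian f f
  have h4 := weightedForm_angularLaplacian (skewEuler f) (skewEuler f)
  rw [weightedForm_laplacian, weightedForm_radialPart]
  rw [h1] at h3 ⊢
  rw [h2] at h4
  simp only [map_neg, map_smul, smul_eq_mul, LinearMap.neg_apply, LinearMap.smul_apply] at h3 h4 ⊢
  linarith

/-- A smooth compactly supported function on the line which is not zero at the origin. -/
theorem exists_smooth_profile : ∃ k : ℝ → ℝ, ContDiff ℝ (⊤ : ℕ∞) k ∧ HasCompactSupport k ∧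
    k 0 ≠ 0 := by
  let b : ContDiffBump (0 : ℝ) := ⟨1, 2, one_pos, one_lt_two⟩
  exact ⟨b, b.contDiff, b.hasCompactSupport, by
    rw [b.one_of_mem_closedBall (by simp [b])]; exact one_ne_zero⟩

theorem exists_angularLaplacian_eq_zero :
    ∃ f : 𝓓(punctured 3, ℂ), angularLaplacian f = 0 ∧ 0 < weightedForm 3 f f := by
  obtain ⟨k, hk, hks, hk0⟩ := exists_smooth_profile
  -- The factor |x|² serves only to vanish at the origin; any radial test function would do.
  obtain ⟨f, hf⟩ := exists_coe_eq_annularFun (p := fun x : Eucl 3 => ‖x‖ ^ 2) (contDiff_norm_sq ℝ)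
    (by simp) hk hks
  refine ⟨f, ?_, ?_⟩
  · have h : ∀ i, angular i f = 0 := fun i => by
      ext x
      rw [angular, coe_linearField, hf, fieldDeriv_annularFun_of_skew (inner_rot_self i)
        ((contDiff_norm_sq ℝ (n := 1)).differentiable (by norm_num))
        (hk.differentiable (by simp))]
      simp [annularFun, inner_rot_self]
    simp [angularLaplacian_apply, h]
  · refine (contDiff_density f f).continuous.integral_pos_of_hasCompactSupport_nonneg_nonzero
      (hasCompactSupport_density f f) (fun x => ?_) (x := EuclideanSpace.single 0 1) ?_
    · exact mul_nonneg (by positivity) real_inner_self_nonneg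
    · simp [density, hf, annularFun, hk0]

theorem deriv_comp_const_mul {k : ℝ → ℝ} (c : ℝ) :
    deriv (fun t => k (c * t)) = fun t => c * deriv k (c * t) := by
  ext t
  simpa using deriv_comp_mul_left c k t

theorem le_of_weightedForm_angularLaplacian_le {C : ℝ}
    (h : ∀ f : 𝓓(punctured 3, ℂ),
      C * weightedForm 3 (angularLaplacian f) (angularLaplacian f)
        ≤ weightedForm 3 (euler 3 (euler 3 f) + euler 3 f + angularLaplacian f)
          (euler 3 (euler 3 f) + euler 3 f + angularLaplacian f)) : C ≤ (5 / 8) ^ 2 := by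
  obtain ⟨k, hk, hks, hk0⟩ := exists_smooth_profile
  set K₀ := ∫ t, k t ^ 2
  set K₁ := ∫ t, deriv k t ^ 2
  set K₂ := ∫ t, deriv (deriv k) t ^ 2
  have hK₀ : 0 < K₀ := (hk.continuous.pow 2).integral_pos_of_hasCompactSupport_nonneg_nonzero
    (hks.comp_left (g := fun y : ℝ => y ^ 2) (by simp)) (fun t => sq_nonneg _) (x := 0)
    (pow_ne_zero 2 hk0)
  -- The dilated profile k(εt) gains a factor ε² in the squared norm for each derivative; the common
  -- factor ε⁻¹ from the change of variable cancels.
  have key : ∀ ε : ℝ, 0 < ε → 4 * C * K₀ ≤ ε ^ 4 * K₂ + 13 / 2 * (ε ^ 2 * K₁) + 25 / 16 * K₀ := by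
    intro ε hε
    set kε : ℝ → ℝ := fun t => k (ε * t) with hkε
    have hc : ContDiff ℝ (⊤ : ℕ∞) kε := hk.comp (contDiff_const.mul contDiff_id)
    have hcs : HasCompactSupport kε := hks.comp_homeomorph (Homeomorph.mulLeft₀ ε hε.ne')
    have hd : ContDiff ℝ (⊤ : ℕ∞) (deriv kε) := (contDiff_infty_iff_deriv.1 hc).2
    choose f hf using fun i : Fin 3 => exists_coe_eq_annularFun
      (p := (EuclideanSpace.proj i : Eucl 3 →L[ℝ] ℝ))
      (EuclideanSpace.proj i : Eucl 3 →L[ℝ] ℝ).contDiff (by simp)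
      (contDiff_logProfile hc) (hasCompactSupport_logProfile hcs)
    have hS := fun i => skewEuler_of_coe_eq_annularFun hc (hf i)
    have hSS := fun i => skewEuler_of_coe_eq_annularFun hd (hS i)
    have h0 := sum_weightedForm_annularFun hf
    have h1 := sum_weightedForm_annularFun hS
    have h2 := sum_weightedForm_annularFun hSS
    have hd1 : deriv kε = fun t => ε * deriv k (ε * t) := deriv_comp_const_mul ε
    have hd2 : deriv (deriv kε) = fun t => ε ^ 2 * deriv (deriv k) (ε * t) := by
      rw [hd1]
      ext t
      rw [deriv_const_mul_field, deriv_comp_const_mul]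
      ring
    have hsc : ∀ g : ℝ → ℝ, ∫ t, g (ε * t) = ε⁻¹ * ∫ t, g t := fun g => by
      rw [Measure.integral_comp_mul_left, abs_of_pos (inv_pos.2 hε), smul_eq_mul]
    have e0 : ∫ t, kε t ^ 2 = ε⁻¹ * K₀ := hsc fun t => k t ^ 2
    have e1 : ∫ t, deriv kε t ^ 2 = ε⁻¹ * (ε ^ 2 * K₁) := by
      simp only [hd1, mul_pow]
      rw [integral_const_mul, hsc fun t => deriv k t ^ 2]
      ring
    have e2 : ∫ t, deriv (deriv kε) t ^ 2 = ε⁻¹ * (ε ^ 4 * K₂) := by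
      simp only [hd2, mul_pow]
      rw [integral_const_mul, hsc fun t => deriv (deriv k) t ^ 2]
      ring
    rw [e0] at h0
    rw [e1] at h1
    rw [e2] at h2
    have hi : ∀ i, 4 * C * weightedForm 3 (f i) (f i)
        ≤ weightedForm 3 (skewEuler (skewEuler (f i))) (skewEuler (skewEuler (f i)))
        + 13 / 2 * weightedForm 3 (skewEuler (f i)) (skewEuler (f i))
        + 25 / 16 * weightedForm 3 (f i) (f i) := fun i => by
      have := h (f i)
      rw [weightedForm_laplacian_of_coe_eq_annularFun hc (hf i),
        angularLaplacian_of_coe_eq_annularFun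
          ((contDiff_logProfile hc).differentiable (by simp)) (hf i)] at this
      simp only [map_neg, map_smul, smul_eq_mul, LinearMap.neg_apply, LinearMap.smul_apply] at this
      linarith
    have hsum := Finset.sum_le_sum fun i (_ : i ∈ Finset.univ) => hi i
    simp only [Finset.sum_add_distrib, ← Finset.mul_sum, h0, h1, h2] at hsum
    have hv : 0 < volume.real (Metric.ball (0 : Eucl 3) 1) :=
      ENNReal.toReal_pos (Metric.measure_ball_pos _ _ one_pos).ne' measure_ball_lt_top.ne
    set v := volume.real (Metric.ball (0 : Eucl 3) 1)
    have hpos : 0 < 3 * v * ε⁻¹ := by positivity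
    refine le_of_mul_le_mul_left ?_ hpos
    linarith
  have hlim : Filter.Tendsto (fun ε : ℝ => ε ^ 4 * K₂ + 13 / 2 * (ε ^ 2 * K₁) + 25 / 16 * K₀)
      (nhdsWithin 0 (Set.Ioi 0)) (nhds (0 ^ 4 * K₂ + 13 / 2 * (0 ^ 2 * K₁) + 25 / 16 * K₀)) :=
    (Continuous.tendsto (by fun_prop) 0).mono_left nhdsWithin_le_nhds
  have hle := ge_of_tendsto hlim (Filter.eventually_of_mem self_mem_nhdsWithin fun ε hε => key ε hε)
  have : C * K₀ ≤ (5 / 8) ^ 2 * K₀ := by linarith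
  exact le_of_mul_le_mul_right this hK₀

end EvansLewis

theorem theorem1p1 :
    (∀ f : 𝓓(EvansLewis.punctured 3, ℂ),
      EvansLewis.l2norm (EvansLewis.radialLaplacian f) ^ 2
          ≤ EvansLewis.l2norm (Δ (f : EvansLewis.Eucl 3 → ℂ)) ^ 2 ∧
      (5 / 8 : ℝ≥0∞) ^ 2 * EvansLewis.l2norm (EvansLewis.sphericalLaplacian f) ^ 2
          ≤ EvansLewis.l2norm (Δ (f : EvansLewis.Eucl 3 → ℂ)) ^ 2) ∧
    (∀ C : ℝ≥0,
      (∀ f : 𝓓(EvansLewis.punctured 3, ℂ),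
        (C : ℝ≥0∞) * EvansLewis.l2norm (EvansLewis.radialLaplacian f) ^ 2
          ≤ EvansLewis.l2norm (Δ (f : EvansLewis.Eucl 3 → ℂ)) ^ 2) →
      C ≤ 1) ∧
    (∀ C : ℝ≥0,
      (∀ f : 𝓓(EvansLewis.punctured 3, ℂ),
        (C : ℝ≥0∞) * EvansLewis.l2norm (EvansLewis.sphericalLaplacian f) ^ 2
          ≤ EvansLewis.l2norm (Δ (f : EvansLewis.Eucl 3 → ℂ)) ^ 2) →
      C ≤ (5 / 8) ^ 2) := by
  simp only [EvansLewis.l2norm_laplacian_sq, EvansLewis.l2norm_radialLaplacian_sq,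
    EvansLewis.l2norm_sphericalLaplacian_sq]
  refine ⟨fun f => ⟨ENNReal.ofReal_le_ofReal (EvansLewis.weightedForm_radialPart_le f), ?_⟩,
    fun C h => ?_, fun C h => ?_⟩
  · have h58 : (5 / 8 : ℝ≥0∞) ^ 2 = ENNReal.ofReal ((5 / 8) ^ 2) := by
      rw [ENNReal.ofReal_pow (by norm_num), ENNReal.ofReal_div_of_pos (by norm_num)]
      simp
    rw [h58, ← ENNReal.ofReal_mul (by positivity)]
    exact ENNReal.ofReal_le_ofReal (EvansLewis.weightedForm_angularLaplacian_le f)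
  · obtain ⟨f, hf, hpos⟩ := EvansLewis.exists_angularLaplacian_eq_zero
    have hC := h f
    rw [hf, add_zero, ← ENNReal.ofReal_coe_nnreal, ← ENNReal.ofReal_mul C.coe_nonneg,
      ENNReal.ofReal_le_ofReal_iff (EvansLewis.weightedForm_self_nonneg _)] at hC
    have hr := EvansLewis.weightedForm_radialPart f
    have h1 := EvansLewis.weightedForm_self_nonneg (EvansLewis.skewEuler f)
    have h2 := EvansLewis.weightedForm_self_nonneg (EvansLewis.skewEuler (EvansLewis.skewEuler f))
    have hN : 0 < EvansLewis.weightedForm 3 (EvansLewis.euler 3 (EvansLewis.euler 3 f)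
        + EvansLewis.euler 3 f) (EvansLewis.euler 3 (EvansLewis.euler 3 f)
        + EvansLewis.euler 3 f) := by
      -- The term (9/16)‖f‖² already makes the radial norm positive.
      rw [hr]
      positivity
    have : (C : ℝ) ≤ 1 := le_of_mul_le_mul_right (by rwa [one_mul]) hN
    exact_mod_cast this
  · have hC : (C : ℝ) ≤ (5 / 8) ^ 2 :=
      EvansLewis.le_of_weightedForm_angularLaplacian_le fun f => by
        have := h f
        rwa [← ENNReal.ofReal_coe_nnreal, ← ENNReal.ofReal_mul C.coe_nonneg,
          ENNReal.ofReal_le_ofReal_iff (EvansLewis.weightedForm_self_nonneg _)] at this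
    rw [← NNReal.coe_le_coe]
    push_cast
    exact hC
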